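/- Let $G=(V,E)$ be a finite simple graph. For $A\subseteq V$ let $N(A)$ be the set of vertices having a neighbor in $A$, and let $d(A)=|A|-|N(A)|$. Let $\alpha(G)$ be the maximum size of an independent set of $G$ and $\mu(G)$ the maximum number of edges in a matching of $G$; $G$ is a König–Egerváry graph if $\alpha(G)+\mu(G)=|V|$. Let $\mathrm{core}(G)$ and $\mathrm{corona}(G)$ be, respectively, the intersection and the union of all independent sets of size $\alpha(G)$. An independent set $S$ is critical independent if $d(S)=\max\{d(I): I\subseteq V \text{ independent}\}$; let $\ker(G)$ and $\mathrm{diadem}(G)$ be, respectively, the intersection and the union of all critical independent sets of $G$. If $G$ is a König–Egerváry graph, then (i) $|\mathrm{corona}(G)|+|\mathrm{core}(G)|=2\alpha(G)$; (ii) $\mathrm{diadem}(G)=\mathrm{corona}(G)$, while the inclusion $\mathrm{diadem}(G)\subseteq\mathrm{corona}(G)$ holds for every finite simple graph $G$, König–Egerváry or not; (iii) $|\ker(G)|+|\mathrm{diadem}(G)|\le 2\alpha(G)$. -/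

import Mathlib

namespace SimpleGraph

variable {V : Type*}

/-- The neighborhood `N(A) = {v : N(v) ∩ A ≠ ∅}` of a set of vertices. It may meet `A`. -/
def setNeighborhood (G : SimpleGraph V) (A : Set V) : Set V :=
  {v | (G.neighborSet v ∩ A).Nonempty}

/-- The difference `d(X) = |X| - |N(X)|`, an integer. -/
noncomputable def difference (G : SimpleGraph V) (X : Set V) : ℤ :=
  (X.ncard : ℤ) - ((G.setNeighborhood X).ncard : ℤ)

/-- The critical independence difference `id_c(G) = max {d(I) : I independent}`. -/
noncomputable def critIndepDifference (G : SimpleGraph V) : ℤ :=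
  sSup {k : ℤ | ∃ I : Set V, G.IsIndepSet I ∧ G.difference I = k}

/-- `A` is critical independent if it is independent and `d(A) = id_c(G)`. -/
def IsCriticalIndepSet (G : SimpleGraph V) (A : Set V) : Prop :=
  G.IsIndepSet A ∧ G.difference A = G.critIndepDifference

/-- The intersection of all critical independent sets. -/
def kerSet (G : SimpleGraph V) : Set V :=
  ⋂₀ {S : Set V | G.IsCriticalIndepSet S}

/-- The union of all critical independent sets. -/
def diadem (G : SimpleGraph V) : Set V :=
  ⋃₀ {S : Set V | G.IsCriticalIndepSet S}

/-- The intersection of all maximum independent sets. -/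
def coreSet [Finite V] (G : SimpleGraph V) : Set V :=
  ⋂ S ∈ {S : Finset V | G.IsMaximumIndepSet S}, (S : Set V)

/-- The union of all maximum independent sets. -/
def corona [Finite V] (G : SimpleGraph V) : Set V :=
  ⋃ S ∈ {S : Finset V | G.IsMaximumIndepSet S}, (S : Set V)

/-- The matching number `μ(G)`, the maximum number of edges of a matching. -/
noncomputable def matchingNumber (G : SimpleGraph V) : ℕ :=
  sSup {n : ℕ | ∃ M : G.Subgraph, M.IsMatching ∧ M.edgeSet.ncard = n}

/-- König–Egerváry graphs: `α(G) + μ(G) = |V(G)|`. -/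
def IsKonigEgervary (G : SimpleGraph V) : Prop :=
  G.indepNum + G.matchingNumber = Nat.card V

/-- On a finite graph the supremum defining `id_c(G)` is a maximum. -/
theorem isGreatest_critIndepDifference [Finite V] (G : SimpleGraph V) :
    IsGreatest {k : ℤ | ∃ I : Set V, G.IsIndepSet I ∧ G.difference I = k}
      G.critIndepDifference := by
  have hfin : {k : ℤ | ∃ I : Set V, G.IsIndepSet I ∧ G.difference I = k}.Finite :=
    (Set.finite_range G.difference).subset (by rintro k ⟨I, -, rfl⟩; exact ⟨I, rfl⟩)
  have hne : {k : ℤ | ∃ I : Set V, G.IsIndepSet I ∧ G.difference I = k}.Nonempty :=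
    ⟨_, ∅, Set.pairwise_empty _, rfl⟩
  exact ⟨hne.csSup_mem hfin, fun k hk => le_csSup hfin.bddAbove hk⟩

/-- On a finite graph the supremum defining `μ(G)` is a maximum. -/
theorem isGreatest_matchingNumber [Finite V] (G : SimpleGraph V) :
    IsGreatest {n : ℕ | ∃ M : G.Subgraph, M.IsMatching ∧ M.edgeSet.ncard = n}
      G.matchingNumber := by
  have hbdd : BddAbove {n : ℕ | ∃ M : G.Subgraph, M.IsMatching ∧ M.edgeSet.ncard = n} := by
    refine ⟨Nat.card (Sym2 V), ?_⟩
    rintro n ⟨M, -, rfl⟩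
    exact Set.ncard_le_card _
  have hne : {n : ℕ | ∃ M : G.Subgraph, M.IsMatching ∧ M.edgeSet.ncard = n}.Nonempty :=
    ⟨_, ⊥, fun v hv => hv.elim, rfl⟩
  exact ⟨Nat.sSup_mem hne hbdd, fun n hn => le_csSup hbdd hn⟩

end SimpleGraph

namespace SimpleGraph

variable {V : Type*} {G : SimpleGraph V}

/-! View a maximum matching as an involution `p` exchanging matched vertices. In a König–Egerváry
graph it has `f = 2α - |V|` fixed points. A maximum independent set `S` contains at most one vertex
of each matched pair, so counting forces it to contain every fixed point and exactly one vertex of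
each pair (`IsMaximumIndepSet.apply_mem_of_notMem`). Hence `p` maps the complement of the corona
onto the core minus the fixed points, which gives (i).

The matching also bounds every difference by `f`, and `S` attains this bound. So maximum independent
sets are critical, whence corona ⊆ diadem and ker ⊆ core. The inclusion diadem ⊆ corona, valid in
any finite graph, is an exchange argument (`IsCriticalIndepSet.ncard_le_ncard_union`). Part (iii)
then follows from (i). -/

theorem Subgraph.IsMatching.ncard_verts_eq_two_mul [Finite V] {M : G.Subgraph}
    (hM : M.IsMatching) : M.verts.ncard = 2 * M.edgeSet.ncard := by
  classical
  have := Fintype.ofFinite V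
  have h := M.spanningCoe.two_mul_card_edgeFinset
  rw [edgeFinset, ← Set.ncard_eq_toFinset_card', Subgraph.edgeSet_spanningCoe] at h
  rw [h, ← Set.ncard_coe_finset]
  have hex : ∀ v : V, v ∈ M.verts → ∃ w, M.Adj v w ∧ ∀ y, M.Adj v y → y = w :=
    fun _ hv => hM hv
  choose! p hp huniq using hex
  -- Uniqueness of partners makes `v ↦ (v, p v)` a bijection from the vertices of `M` onto its
  -- ordered adjacent pairs, two per edge.
  refine Set.ncard_congr (fun v _ => (v, p v)) ?_ ?_ ?_
  · intro v hv
    simpa using hp v hv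
  · intro a b _ _ hab
    exact (Prod.mk.inj hab).1
  · rintro ⟨a, b⟩ hab
    have hab : M.Adj a b := by simpa using hab
    exact ⟨a, hab.fst_mem, by rw [huniq a hab.fst_mem b hab]⟩

/-- A matching, presented as the involution exchanging matched vertices and fixing the others. -/
theorem Subgraph.IsMatching.exists_involutive [Finite V] {M : G.Subgraph} (hM : M.IsMatching) :
    ∃ p : V → V, p.Involutive ∧ (∀ v, p v ≠ v → G.Adj v (p v)) ∧
      {v | p v = v}.ncard + 2 * M.edgeSet.ncard = Nat.card V := by
  classical
  have hcard := hM.ncard_verts_eq_two_mul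
  have hex : ∀ v : V, v ∈ M.verts → ∃ w, M.Adj v w ∧ ∀ y, M.Adj v y → y = w :=
    fun _ hv => hM hv
  choose! q hq huniq using hex
  have hqv : ∀ v ∈ M.verts, q v ∈ M.verts := fun v hv => (hq v hv).snd_mem
  refine ⟨fun v => if v ∈ M.verts then q v else v, ?_, ?_, ?_⟩
  · intro v
    by_cases hv : v ∈ M.verts
    · simp only [hv, hqv v hv, if_true]
      exact (huniq (q v) (hqv v hv) v (hq v hv).symm).symm
    · simp [hv]
  · intro v hv
    by_cases hmem : v ∈ M.verts
    · simpa [hmem] using (hq v hmem).adj_sub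
    · simp [hmem] at hv
  · have : {v | (if v ∈ M.verts then q v else v) = v} = M.vertsᶜ := by
      ext v
      by_cases hv : v ∈ M.verts
      · simpa [hv] using (hq v hv).adj_sub.ne'
      · simp [hv]
    rw [this, ← hcard, add_comm, Set.ncard_add_ncard_compl]

/-- In a König–Egerváry graph, a maximum matching is an involution with `2 α(G) - |V|` fixed
points. -/
theorem IsKonigEgervary.exists_involutive [Finite V] (hG : G.IsKonigEgervary) :
    ∃ p : V → V, p.Involutive ∧ (∀ v, p v ≠ v → G.Adj v (p v)) ∧
      {v | p v = v}.ncard + Nat.card V = 2 * G.indepNum := by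
  obtain ⟨M, hM, hcard⟩ := G.isGreatest_matchingNumber.1
  obtain ⟨p, hp, hadj, hfix⟩ := hM.exists_involutive
  refine ⟨p, hp, hadj, ?_⟩
  unfold IsKonigEgervary at hG
  omega

theorem IsIndepSet.ncard_le_indepNum [Finite V] {A : Set V} (hA : G.IsIndepSet A) :
    A.ncard ≤ G.indepNum := by
  rw [Set.ncard_eq_toFinset_card A]
  exact IsIndepSet.card_le_indepNum (by simpa using hA)

theorem IsIndepSet.disjoint_setNeighborhood {A : Set V} (hA : G.IsIndepSet A) :
    Disjoint A (G.setNeighborhood A) := by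
  refine Set.disjoint_left.2 fun v hv ⟨w, hvw, hw⟩ => hA hv hw ?_ hvw
  exact Adj.ne hvw

theorem setNeighborhood_mono {A B : Set V} (h : A ⊆ B) :
    G.setNeighborhood A ⊆ G.setNeighborhood B :=
  fun _ hv => hv.mono (Set.inter_subset_inter_right _ h)

theorem mem_corona [Finite V] {v : V} :
    v ∈ G.corona ↔ ∃ S : Finset V, G.IsMaximumIndepSet S ∧ v ∈ S := by
  simp [corona]

theorem mem_coreSet [Finite V] {v : V} :
    v ∈ G.coreSet ↔ ∀ S : Finset V, G.IsMaximumIndepSet S → v ∈ S := by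
  simp [coreSet]

theorem IsIndepSet.subset_corona [Finite V] {A : Set V} (hA : G.IsIndepSet A)
    (hcard : G.indepNum ≤ A.ncard) : A ⊆ G.corona := by
  intro v hv
  refine mem_corona.2 ⟨A.toFinite.toFinset, ⟨by simpa using hA, fun t ht => ?_⟩, by simpa using hv⟩
  rw [← Set.ncard_eq_toFinset_card A]
  exact ht.card_le_indepNum.trans hcard

theorem IsCriticalIndepSet.difference_le [Finite V] {A I : Set V} (hA : G.IsCriticalIndepSet A)
    (hI : G.IsIndepSet I) : G.difference I ≤ G.difference A :=
  hA.2 ▸ G.isGreatest_critIndepDifference.2 ⟨I, hI, rfl⟩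

theorem isCriticalIndepSet_of_forall_difference_le [Finite V] {A : Set V} (hA : G.IsIndepSet A)
    (h : ∀ I, G.IsIndepSet I → G.difference I ≤ G.difference A) : G.IsCriticalIndepSet A := by
  refine ⟨hA, le_antisymm (G.isGreatest_critIndepDifference.2 ⟨A, hA, rfl⟩) ?_⟩
  obtain ⟨I, hI, hd⟩ := G.isGreatest_critIndepDifference.1
  exact hd ▸ h I hI

/-- Replacing the neighbors of a critical independent set `A` in an independent set `S` by `A`
does not decrease the size of `S`. -/
theorem IsCriticalIndepSet.ncard_le_ncard_union [Finite V] {A S : Set V}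
    (hA : G.IsCriticalIndepSet A) (hS : G.IsIndepSet S) :
    S.ncard ≤ (A ∪ (S \ G.setNeighborhood A)).ncard := by
  -- Testing criticality on `A ∩ S`, whose neighborhood avoids `S`, gives `|N(A) ∩ S| ≤ |A \ S|`: at
  -- least as much is gained as is removed.
  have hd := hA.difference_le (I := A ∩ S) (hA.1.mono Set.inter_subset_left)
  have hdisj := hA.1.disjoint_setNeighborhood
  have hN : G.setNeighborhood (A ∩ S) ⊆ G.setNeighborhood A \ S := fun v hv =>
    ⟨setNeighborhood_mono Set.inter_subset_left hv, fun hvS =>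
      Set.disjoint_left.1 hS.disjoint_setNeighborhood hvS
        (setNeighborhood_mono Set.inter_subset_right hv)⟩
  have h1 := Set.ncard_le_ncard hN
  have h2 := Set.ncard_inter_add_ncard_sdiff_eq_ncard (G.setNeighborhood A) S
  have h3 := Set.ncard_inter_add_ncard_sdiff_eq_ncard S (G.setNeighborhood A)
  have h4 := Set.ncard_union_add_ncard_inter A (S \ G.setNeighborhood A)
  have h5 : A ∩ (S \ G.setNeighborhood A) = A ∩ S := by
    ext v
    have : v ∈ A → v ∉ G.setNeighborhood A := fun h => Set.disjoint_left.1 hdisj h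
    simp only [Set.mem_inter_iff, Set.mem_sdiff]
    tauto
  rw [h5] at h4
  rw [Set.inter_comm S] at h3
  unfold difference at hd
  omega

theorem IsIndepSet.union_diff_setNeighborhood {A S : Set V} (hA : G.IsIndepSet A)
    (hS : G.IsIndepSet S) : G.IsIndepSet (A ∪ (S \ G.setNeighborhood A)) := by
  rintro v (hv | hv) w (hw | hw) hne hadj
  · exact hA hv hw hne hadj
  · exact hw.2 ⟨v, hadj.symm, hv⟩
  · exact hv.2 ⟨w, hadj, hw⟩
  · exact hS hv.1 hw.1 hne hadj

/-- The exchange turns any maximum independent set into one that contains the given critical set. -/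
theorem diadem_subset_corona [Finite V] (G : SimpleGraph V) : G.diadem ⊆ G.corona := by
  rintro v ⟨A, hA, hv⟩
  have hA : G.IsCriticalIndepSet A := hA
  obtain ⟨S, hS⟩ := G.maximumIndepSet_exists
  refine (hA.1.union_diff_setNeighborhood hS.isIndepSet).subset_corona ?_ (Or.inl hv)
  rw [← maximumIndepSet_card_eq_indepNum S hS, ← Set.ncard_coe_finset]
  exact hA.ncard_le_ncard_union hS.isIndepSet

section Involution

variable {p : V → V}

theorem IsIndepSet.apply_notMem_of_mem {S : Set V} (hS : G.IsIndepSet S)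
    (hadj : ∀ v, p v ≠ v → G.Adj v (p v)) {v : V} (hv : v ∈ S) (hne : p v ≠ v) : p v ∉ S :=
  fun h => hS hv h hne.symm (hadj v hne)

/-- A maximum independent set contains the partner of every vertex outside it. -/
theorem IsMaximumIndepSet.apply_mem_of_notMem [Finite V] {S : Finset V}
    (hS : G.IsMaximumIndepSet S) (hp : p.Involutive) (hadj : ∀ v, p v ≠ v → G.Adj v (p v))
    (hfix : {v | p v = v}.ncard + Nat.card V = 2 * G.indepNum) {v : V} (hv : v ∉ S) :
    p v ∈ S := by
  have hcard := maximumIndepSet_card_eq_indepNum S hS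
  rw [← Set.ncard_coe_finset] at hcard
  have hsub : p '' ((S : Set V) \ {v | p v = v}) ⊆ (S : Set V)ᶜ := by
    rintro _ ⟨w, hw, rfl⟩
    exact hS.isIndepSet.apply_notMem_of_mem hadj hw.1 hw.2
  have h1 := Set.ncard_image_of_injective ((S : Set V) \ {v | p v = v}) hp.injective
  have h2 := Set.ncard_add_ncard_compl (S : Set V)
  have h3 := Set.ncard_le_ncard_sdiff_add_ncard (S : Set V) {v | p v = v}
  -- Discarding at most `2α - |V|` fixed points from `S` leaves at least `|V| - α` vertices, the
  -- size of its complement.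
  have heq := Set.eq_of_subset_of_ncard_le hsub (by omega)
  obtain ⟨w, hw, rfl⟩ : v ∈ p '' ((S : Set V) \ {v | p v = v}) := heq ▸ hv
  rw [hp w]
  exact hw.1

/-- The non-fixed vertices of `I` have distinct partners, all in `N(I)`. -/
theorem difference_le_ncard_fixed [Finite V] (I : Set V) (hp : p.Involutive) (hadj : ∀ v, p v ≠ v → G.Adj v (p v)) :
    G.difference I ≤ {v | p v = v}.ncard := by
  have hsub : p '' (I \ {v | p v = v}) ⊆ G.setNeighborhood I := by
    rintro _ ⟨w, hw, rfl⟩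
    exact ⟨w, (hadj w hw.2).symm, hw.1⟩
  have h1 := Set.ncard_image_of_injective (I \ {v | p v = v}) hp.injective
  have h2 := Set.ncard_le_ncard hsub
  have h3 := Set.ncard_le_ncard_sdiff_add_ncard I {v | p v = v}
  unfold difference
  omega

end Involution

/-- Since `N(S)` lies outside `S`, `d(S) ≥ 2α - |V|`, which is the upper bound given by the
matching. -/
theorem IsKonigEgervary.isCriticalIndepSet [Finite V] (hG : G.IsKonigEgervary) {S : Finset V}
    (hS : G.IsMaximumIndepSet S) : G.IsCriticalIndepSet S := by
  obtain ⟨p, hp, hadj, hfix⟩ := hG.exists_involutive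
  refine isCriticalIndepSet_of_forall_difference_le hS.isIndepSet fun I _ =>
    (difference_le_ncard_fixed I hp hadj).trans ?_
  have hcard := maximumIndepSet_card_eq_indepNum S hS
  rw [← Set.ncard_coe_finset] at hcard
  have h1 := Set.ncard_le_ncard hS.isIndepSet.disjoint_setNeighborhood.subset_compl_left
  have h2 := Set.ncard_add_ncard_compl (S : Set V)
  unfold difference
  omega

theorem IsKonigEgervary.diadem_eq_corona [Finite V] (hG : G.IsKonigEgervary) :
    G.diadem = G.corona := by
  refine G.diadem_subset_corona.antisymm fun v hv => ?_
  obtain ⟨S, hS, hvS⟩ := mem_corona.1 hv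
  exact ⟨S, hG.isCriticalIndepSet hS, hvS⟩

theorem IsKonigEgervary.kerSet_subset_coreSet [Finite V] (hG : G.IsKonigEgervary) :
    G.kerSet ⊆ G.coreSet :=
  fun _ hv => mem_coreSet.2 fun S hS => hv S (hG.isCriticalIndepSet hS)

theorem IsKonigEgervary.ncard_corona_add_ncard_coreSet [Finite V] (hG : G.IsKonigEgervary) :
    G.corona.ncard + G.coreSet.ncard = 2 * G.indepNum := by
  obtain ⟨p, hp, hadj, hfix⟩ := hG.exists_involutive
  have hmem {S : Finset V} (hS : G.IsMaximumIndepSet S) {v : V} (hv : v ∉ S) : p v ∈ S :=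
    hS.apply_mem_of_notMem hp hadj hfix hv
  have hfixed : {v | p v = v} ⊆ G.coreSet := fun v hv => mem_coreSet.2 fun S hS => by
    by_contra hvS
    exact hvS (Eq.subst (motive := (· ∈ S)) hv (hmem hS hvS))
  -- A vertex lies in no maximum independent set exactly when it is matched and its partner lies in
  -- all of them.
  have himage : p '' G.coronaᶜ = G.coreSet \ {v | p v = v} := by
    ext v
    constructor
    · rintro ⟨w, hw, rfl⟩
      have hw' (S : Finset V) (hS : G.IsMaximumIndepSet S) : w ∉ S :=
        fun h => hw (mem_corona.2 ⟨S, hS, h⟩)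
      refine ⟨mem_coreSet.2 fun S hS => hmem hS (hw' S hS), fun h => ?_⟩
      obtain ⟨S, hS⟩ := G.maximumIndepSet_exists
      have h : p (p w) = p w := h
      rw [hp w] at h
      exact hw' S hS (h ▸ hmem hS (hw' S hS))
    · rintro ⟨hv, hne⟩
      refine ⟨p v, fun hc => ?_, hp v⟩
      obtain ⟨S, hS, hvS⟩ := mem_corona.1 hc
      exact hS.isIndepSet.apply_notMem_of_mem hadj (mem_coreSet.1 hv S hS) hne hvS
  have h1 := Set.ncard_image_of_injective G.coronaᶜ hp.injective
  have h2 := Set.ncard_add_ncard_compl G.corona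
  have h3 := Set.ncard_sdiff_add_ncard_of_subset hfixed
  rw [himage] at h1
  omega

end SimpleGraph

theorem mainTheorem4 {V : Type*} [Finite V] (G : SimpleGraph V) :
    (G.IsKonigEgervary →
      G.corona.ncard + G.coreSet.ncard = 2 * G.indepNum ∧
      G.diadem = G.corona ∧
      G.kerSet.ncard + G.diadem.ncard ≤ 2 * G.indepNum) ∧
    G.diadem ⊆ G.corona := by
  refine ⟨fun hG => ⟨hG.ncard_corona_add_ncard_coreSet, hG.diadem_eq_corona, ?_⟩,
    G.diadem_subset_corona⟩
  rw [hG.diadem_eq_corona, ← hG.ncard_corona_add_ncard_coreSet, add_comm]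
  exact Nat.add_le_add_left (Set.ncard_le_ncard hG.kerSet_subset_coreSet) _
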